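/- For integers $p,q,r,a,b,c$ let $K\left(\begin{smallmatrix} p & q & r\\ a & b & c\end{smallmatrix}\right)$ be the unoriented link in 3-space with the following diagram. Fix a circle in the plane, divided into six consecutive arcs $A_1,B_1,A_2,B_2,A_3,B_3$. Take a Y-shaped tree on one side of the circle with its three leaves on $A_1,A_2,A_3$, and a Y-shaped tree on the other side with its three leaves on $B_1,B_2,B_3$. Thicken each tree to a Y-shaped band surface (a disk), whose three ends are the arcs $A_i$, respectively $B_i$, and put $p,q,r$ half twists (crossings) in the bands ending on $A_1,A_2,A_3$ and $a,b,c$ half twists in the bands ending on $B_1,B_2,B_3$, so that the six bands occur around the circle in the order $p,a,q,b,r,c$. The link consists of the boundary edges of the bands, which meet at the six division points of the circle. The sign of a label fixes the handedness of its half twists, by the same rule for all six bands: the crossings of a band with positive label are positive crossings when the two edges of the band are given opposite directions along the band. Links are considered equal if they are isotopic (equivalently, if their diagrams are related by planar isotopy and Reidemeister moves); mirror images are not identified. For $n\ge 0$ let $S_n=S_n(A)=\sum_{i=1}^{n}A^{2-i}(-A^3)^{n-i}\in\mathbb Z[A,A^{-1}]$ (so $S_0=0$), and let $S_{-n}(A)=S_n(A^{-1})$.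 **Theorem.** Let $p,q,r,a,b,c$ be even integers. If $K\left(\begin{smallmatrix} p & q & r\\ a & b & c\end{smallmatrix}\right)=K\left(\begin{smallmatrix} p & q & r\\ c & a & b\end{smallmatrix}\right)$, then $$\left|\begin{matrix} S_pA^p & S_qA^q & S_rA^r\\ S_cA^c & S_aA^a & S_bA^b\\ 1&1&1\end{matrix}\right|=0 .$$ If $K\left(\begin{smallmatrix} p & q & r\\ a & b & c\end{smallmatrix}\right)=K\left(\begin{smallmatrix} p & q & r\\ b & c & a\end{smallmatrix}\right)$, then $$\left|\begin{matrix} S_pA^p & S_qA^q & S_rA^r\\ S_aA^a & S_bA^b & S_cA^c\\ 1&1&1\end{matrix}\right|=0 .$$ -/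

import Mathlib

/-!
# Link diagrams, links, and the diagrams `K(p, q, r; a, b, c)`

Unoriented link diagrams in the plane, in general position with respect to the height function,
are cut by horizontal lines into elementary slices, each containing a single local minimum,
a single local maximum or a single crossing, next to vertical strands. A diagram is thus a word in
such slices, read from the bottom to the top. Links are link diagrams up to planar isotopy and the
three Reidemeister moves, which for diagrams in general position amount to the local moves
`LinkDiagram.LocalMove`. Mirror images are not identified.
-/

/-- The elementary pieces of a link diagram in general position with respect to the height:
a local minimum `cup`, a local maximum `cap`, and a crossing of two strands. In `crossing true` the
strand running from the bottom left to the top right is the over-strand, in `crossing false` it is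
the under-strand. -/
inductive Piece where
  | cup : Piece
  | cap : Piece
  | crossing (rising : Bool) : Piece

namespace Piece

/-- The number of strands entering a piece from below. -/
def ins : Piece → ℕ
  | cup => 0
  | cap => 2
  | crossing _ => 2

/-- The number of strands leaving a piece at the top. -/
def outs : Piece → ℕ
  | cup => 2
  | cap => 0
  | crossing _ => 2

end Piece

/-- A horizontal slice of a diagram: one elementary piece with exactly `pos` vertical strands to
the left of it (and any number of vertical strands to the right of it). -/
structure Slice where
  piece : Piece
  pos : ℕ

/-- `IsTangle w m n`: the slices in `w` can be stacked, from the bottom to the top, to a tangle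
diagram with `m` endpoints at the bottom and `n` endpoints at the top. -/
def IsTangle : List Slice → ℕ → ℕ → Prop
  | [], m, n => m = n
  | s :: w, m, n => s.pos + s.piece.ins ≤ m ∧ IsTangle w (m - s.piece.ins + s.piece.outs) n

theorem IsTangle.append {u v : List Slice} {l m n : ℕ} (hu : IsTangle u l m)
    (hv : IsTangle v m n) : IsTangle (u ++ v) l n := by
  induction u generalizing l with
  | nil => cases hu; exact hv
  | cons s u ih => exact ⟨hu.1, ih hu.2⟩

/-- A link diagram: a stack of slices without endpoints. -/
structure LinkDiagram where
  word : List Slice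
  closed : IsTangle word 0 0

namespace LinkDiagram

/-- The local moves. The first four are planar isotopies, the last three are the Reidemeister
moves. -/
inductive LocalMove : List Slice → List Slice → Prop
  /-- Two pieces with disjoint sets of strands exchange their heights; `k` strands run between
  them. -/
  | exchange (x y : Piece) (i k : ℕ) :
      LocalMove [⟨x, i⟩, ⟨y, i + x.outs + k⟩] [⟨y, i + x.ins + k⟩, ⟨x, i⟩]
  /-- A strand with a local minimum followed by a local maximum to its right is straightened. -/
  | zigzag_right (i : ℕ) : LocalMove [⟨.cup, i⟩, ⟨.cap, i + 1⟩] []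
  /-- A strand with a local minimum followed by a local maximum to its left is straightened. -/
  | zigzag_left (i : ℕ) : LocalMove [⟨.cup, i + 1⟩, ⟨.cap, i⟩] []
  /-- A strand crossing the left leg of a local maximum is moved to its right leg. The strand stays
  on the same side (over or under) of the maximum. -/
  | slide_cap (i : ℕ) (e : Bool) :
      LocalMove [⟨.crossing e, i⟩, ⟨.cap, i + 1⟩] [⟨.crossing (!e), i + 1⟩, ⟨.cap, i⟩]
  /-- A strand crossing the left leg of a local minimum is moved to its right leg. The strand stays
  on the same side (over or under) of the minimum. -/
  | slide_cup (i : ℕ) (e : Bool) :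
      LocalMove [⟨.cup, i + 1⟩, ⟨.crossing e, i⟩] [⟨.cup, i⟩, ⟨.crossing (!e), i + 1⟩]
  /-- First Reidemeister move: a curl at a local maximum is removed. -/
  | reidemeister_one_cap (i : ℕ) (e : Bool) :
      LocalMove [⟨.crossing e, i⟩, ⟨.cap, i⟩] [⟨.cap, i⟩]
  /-- First Reidemeister move: a curl at a local minimum is removed. -/
  | reidemeister_one_cup (i : ℕ) (e : Bool) :
      LocalMove [⟨.cup, i⟩, ⟨.crossing e, i⟩] [⟨.cup, i⟩]
  /-- Second Reidemeister move: two strands, one of them lying over the other one, are separated. -/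
  | reidemeister_two (i : ℕ) (e : Bool) :
      LocalMove [⟨.crossing e, i⟩, ⟨.crossing (!e), i⟩] []
  /-- Third Reidemeister move for three strands with bottom ends `1, 2, 3`: here `e`, `f`, `g` tell
  whether `1` is over `2`, `1` is over `3`, `2` is over `3`. The condition says that the three
  strands lie at three different levels, one above the other. -/
  | reidemeister_three (i : ℕ) (e f g : Bool) (h : f = e ∨ f = g) :
      LocalMove [⟨.crossing e, i⟩, ⟨.crossing f, i + 1⟩, ⟨.crossing g, i⟩]
        [⟨.crossing g, i + 1⟩, ⟨.crossing f, i⟩, ⟨.crossing e, i + 1⟩]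

/-- `D'` arises from `D` by one local move inside the diagram. -/
def Move (D D' : LinkDiagram) : Prop :=
  ∃ u v l r : List Slice, LocalMove l r ∧ D.word = u ++ l ++ v ∧ D'.word = u ++ r ++ v

end LinkDiagram

/-- Unoriented links in 3-space up to isotopy: link diagrams modulo the equivalence relation
generated by the local moves. -/
def Link : Type := Quot LinkDiagram.Move

/-- `|k|` half twists of the strands `i` and `i + 1`. The strand running from the bottom left to the
top right passes under if `k > 0` and over if `k < 0`. (So a crossing of a twist with `k > 0` whose
two strands have opposite directions is a positive crossing.) -/
def twist (i : ℕ) (k : ℤ) : List Slice :=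
  List.replicate k.natAbs ⟨.crossing (decide (k < 0)), i⟩

theorem isTangle_twist {i m : ℕ} (k : ℤ) (h : i + 2 ≤ m) : IsTangle (twist i k) m m := by
  unfold twist
  induction k.natAbs with
  | zero => exact rfl
  | succ n ih =>
    refine ⟨h, ?_⟩
    have e : m - 2 + 2 = m := by omega
    simpa [Piece.ins, Piece.outs, e] using ih

/-- The diagram `K(p, q, r; a, b, c)` of girth three, given by two Y-shaped trees glued along a
circle. The six points of the knot on the circle are the strands `0, …, 5` between the first and the
second half of the word.

One side of the circle is below. It contains a Y-shaped region with three bands, which are bounded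
by the pairs of strands `01`, `23`, `45` and have `p`, `q`, `r` half twists.

The other side of the circle is above. It contains a Y-shaped region with three bands with `a`, `b`,
`c` half twists, where the first two are bounded by the pairs of strands `12` and `34` and the third
one, which ends on the outer arc from `5` to `0`, by the two middle strands of the four strands that
remain after the maximum between the first two. In the cyclic order along the circle, the six bands
are thus those of `p, a, q, b, r, c`. -/
def girthThreeDiagram (p q r a b c : ℤ) : LinkDiagram where
  word :=
    ([⟨.cup, 0⟩, ⟨.cup, 1⟩, ⟨.cup, 3⟩] ++ twist 0 p ++ twist 2 q ++ twist 4 r) ++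
    (twist 1 a ++ twist 3 b ++ [⟨.cap, 2⟩] ++ twist 1 c ++ [⟨.cap, 0⟩, ⟨.cap, 0⟩])
  closed := by
    have h₁ : IsTangle [⟨.cup, 0⟩, ⟨.cup, 1⟩, ⟨.cup, 3⟩] 0 6 := by
      simp [IsTangle, Piece.ins, Piece.outs]
    have h₂ : IsTangle [⟨.cap, 2⟩] 6 4 := by simp [IsTangle, Piece.ins, Piece.outs]
    have h₃ : IsTangle [⟨.cap, 0⟩, ⟨.cap, 0⟩] 4 0 := by simp [IsTangle, Piece.ins, Piece.outs]
    have t : ∀ i k, i + 2 ≤ 6 → IsTangle (twist i k) 6 6 := fun i k h => isTangle_twist k h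
    have t' : IsTangle (twist 1 c) 4 4 := isTangle_twist c (by norm_num)
    exact (((h₁.append (t 0 p (by norm_num))).append (t 2 q (by norm_num))).append
      (t 4 r (by norm_num))).append
      (((((t 1 a (by norm_num)).append (t 3 b (by norm_num))).append h₂).append t').append h₃)

/-- The link `K(p, q, r; a, b, c)`. -/
def girthThreeLink (p q r a b c : ℤ) : Link :=
  Quot.mk _ (girthThreeDiagram p q r a b c)

open LaurentPolynomial in
/-- The Laurent polynomial `S_n(A) = ∑_{i = 1}^n A^(2 - i) (-A³)^(n - i)` for `n ≥ 0`; the variable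
`A` is `T 1`, and `A ^ k` is `T k`. -/
noncomputable def twistPolyNat (n : ℕ) : LaurentPolynomial ℤ :=
  ∑ i ∈ Finset.Icc 1 n, T (2 - (i : ℤ)) * (-T 3) ^ (n - i)

/-- The Laurent polynomial `S_p(A)` for an integer `p`, where `S_{-p}(A) = S_p(A⁻¹)` for `p > 0`. -/
noncomputable def twistPoly (p : ℤ) : LaurentPolynomial ℤ :=
  if 0 ≤ p then twistPolyNat p.toNat else LaurentPolynomial.invert (twistPolyNat (-p).toNat)

/-! ## The Kauffman bracket as a state sum -/

namespace KauffmanBracket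

variable {R : Type*} [CommRing R] (A : Rˣ)

/-! The proof compares Kauffman brackets. The bracket is realised as a vertex model: strands carry
one of two labels, a slice acts on functionals of labellings, and a crossing is a combination of the
identity and a maximum followed by a minimum. Every local move preserves this action up to a power
of `-A^3`, so equal links have brackets that agree up to such a power (`bracket_eq_of_link_eq`).

A band with `k` half twists acts as `A^(-k)` times the uncut band plus `S_k` times the cut band
(`pull_twist`). Summing over the cut and uncut states of the six bands gives the bracket as an
explicit polynomial (`bracket_girthThreeDiagram`). After the common unit is factored out, a band
enters only through `z_k = S_k A^k`, the entries of the determinant. Rotating `a, b, c` changes the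
polynomial by `d^3 - d` times, up to sign, the determinant (`girthThreePoly_one_sub`), where `d =
-A^2 - A^(-2)`. Since `d^3 - d` is nonzero in a domain, equal brackets force the determinant to
vanish.

It remains to remove the power of `-A^3`, and only here are the labels required to be even. The
bracket is expanded to first order at `A = 1`. Its value there is `-2`, and its derivative is a sum
of one term per band, hence unchanged when `a, b, c` are permuted. The value fixes the sign of the
power and the derivative fixes its exponent (`bracket_eq_of_girthThreeLink_eq`). -/

/-- The weight of a local maximum whose two legs carry the given labels. -/
def capWeight : Bool → Bool → R
  | false, true => 1
  | true, false => -(↑A⁻¹ : R) ^ 2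
  | _, _ => 0

/-- The sum over the labels of the two legs of a local minimum. -/
def cupSum (f : Bool → Bool → R) : R :=
  -(A : R) ^ 2 * f false true + f true false

/-- A piece at the left end of a slice, acting on functionals on labelled strands. -/
def headAct : Piece → (List Bool → R) → List Bool → R
  | .cup, ψ, l => cupSum A fun x y => ψ (x :: y :: l)
  | .cap, ψ, x :: y :: l => capWeight A x y * ψ l
  | .crossing e, ψ, x :: y :: l =>
      (bif e then (A : R) else ↑A⁻¹) * ψ (x :: y :: l) +
      (bif e then (↑A⁻¹ : R) else A) * (capWeight A x y * cupSum A fun x y => ψ (x :: y :: l))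
  | _, _, _ => 0

/-- A piece with a number of vertical strands to the left of it, acting on functionals on labelled
strands. -/
def act (p : Piece) : ℕ → (List Bool → R) → List Bool → R
  | 0, ψ, l => headAct A p ψ l
  | i + 1, ψ, x :: l => act p i (fun l => ψ (x :: l)) l
  | _ + 1, _, [] => 0

/-- The action of a word of slices on functionals: a functional on the strands at the top is pulled
back to the strands at the bottom. -/
def pull : List Slice → (List Bool → R) → List Bool → R
  | [], ψ => ψ
  | s :: w, ψ => act A s.piece s.pos (pull w ψ)

theorem pull_append (u v : List Slice) (ψ : List Bool → R) :
    pull A (u ++ v) ψ = pull A u (pull A v ψ) := by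
  induction u with
  | nil => rfl
  | cons s u ih => simp [pull, ih]

theorem headAct_linear (p : Piece) (c d : R) (ψ φ : List Bool → R) (l : List Bool) :
    headAct A p (fun l => c * ψ l + d * φ l) l = c * headAct A p ψ l + d * headAct A p φ l := by
  rcases p with _ | _ | e <;> rcases l with _ | ⟨x, _ | ⟨y, l⟩⟩ <;>
    simp only [headAct, cupSum] <;> ring

theorem act_linear (p : Piece) (i : ℕ) (c d : R) (ψ φ : List Bool → R) (l : List Bool) :
    act A p i (fun l => c * ψ l + d * φ l) l = c * act A p i ψ l + d * act A p i φ l := by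
  induction i generalizing ψ φ l with
  | zero => exact headAct_linear A p c d ψ φ l
  | succ i ih =>
    rcases l with _ | ⟨x, l⟩
    · simp [act]
    · exact ih _ _ l

theorem act_mul (p : Piece) (i : ℕ) (c : R) (ψ : List Bool → R) (l : List Bool) :
    act A p i (fun l => c * ψ l) l = c * act A p i ψ l := by
  simpa using act_linear A p i c 0 ψ ψ l

theorem pull_linear (w : List Slice) (c d : R) (ψ φ : List Bool → R) (l : List Bool) :
    pull A w (fun l => c * ψ l + d * φ l) l = c * pull A w ψ l + d * pull A w φ l := by
  induction w generalizing l with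
  | nil => rfl
  | cons s w ih =>
    simp only [pull]
    rw [← act_linear]
    congr 1
    funext l
    exact ih l

theorem pull_mul (w : List Slice) (c : R) (ψ : List Bool → R) (l : List Bool) :
    pull A w (fun l => c * ψ l) l = c * pull A w ψ l := by
  simpa using pull_linear A w c 0 ψ ψ l

/-- Only labellings of the correct length matter. The action takes the junk value `0` on lists that
are too short, so the identities below hold under length hypotheses, and this lemma lets them be
used inside a larger diagram. -/
theorem act_congr (p : Piece) (i : ℕ) {ψ φ : List Bool → R} {l : List Bool}
    (hl : i + p.ins ≤ l.length)
    (h : ∀ l' : List Bool, l'.length = l.length - p.ins + p.outs → ψ l' = φ l') :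
    act A p i ψ l = act A p i φ l := by
  induction i generalizing ψ φ l with
  | zero =>
    rcases p with _ | _ | e <;> rcases l with _ | ⟨x, _ | ⟨y, l⟩⟩ <;>
      simp_all [act, headAct, cupSum, Piece.ins, Piece.outs]
  | succ i ih =>
    rcases l with _ | ⟨x, l⟩
    · rfl
    · simp only [List.length_cons] at hl h
      refine ih (by omega) fun l' hl' => h _ ?_
      simp only [List.length_cons]
      omega

theorem pull_congr {w : List Slice} {m n : ℕ} (hw : IsTangle w m n) {ψ φ : List Bool → R}
    (h : ∀ l : List Bool, l.length = n → ψ l = φ l) {l : List Bool} (hl : l.length = m) :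
    pull A w ψ l = pull A w φ l := by
  induction w generalizing m l with
  | nil => exact h l (hl.trans hw)
  | cons s w ih =>
    subst hl
    exact act_congr A s.piece s.pos hw.1 fun l' hl' => ih hw.2 hl'

/-! ### Invariance under the local moves -/

/-- At the left end, `x` acts by a linear combination of relabellings of its own strands, with
coefficients that do not involve the strands to the right. By linearity the action of `y` passes
through it. -/
theorem act_exchange (x y : Piece) (i k : ℕ) (ψ : List Bool → R) (l : List Bool) :
    act A x i (act A y (i + x.outs + k) ψ) l = act A y (i + x.ins + k) (act A x i ψ) l := by
  induction i generalizing ψ l with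
  | zero =>
    rcases x with _ | _ | e
    · have := act_linear A y k (-(A : R) ^ 2) 1 (fun l => ψ (false :: true :: l))
        (fun l => ψ (true :: false :: l)) l
      simpa [Piece.ins, Piece.outs, act, headAct, cupSum, Nat.add_comm _ k] using this.symm
    · rcases l with _ | ⟨u, _ | ⟨v, l⟩⟩ <;>
        simp [Piece.ins, Piece.outs, act, headAct, Nat.add_comm _ k, act_mul]
    · rcases l with _ | ⟨u, _ | ⟨v, l⟩⟩ <;>
        simp only [Piece.ins, Piece.outs, act, headAct, Nat.add_comm _ k, zero_add,
          cupSum]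
      rw [act_linear, act_mul, ← one_mul (act A y k (fun l => ψ (true :: false :: l)) l),
        ← act_linear]
      simp
  | succ i ih =>
    rw [show i + 1 + x.outs + k = i + x.outs + k + 1 by omega,
      show i + 1 + x.ins + k = i + x.ins + k + 1 by omega]
    rcases l with _ | ⟨u, l⟩
    · rfl
    · exact ih _ l

/-- The factor by which the bracket changes when a curl is removed. -/
def curl : Rˣ := -A ^ 3

/-- Two words act in the same way on functionals, up to a factor. -/
def ActsAs (c : R) (m : ℕ) (u v : List Slice) : Prop :=
  ∀ (ψ : List Bool → R) (l : List Bool), m ≤ l.length → pull A u ψ l = c * pull A v ψ l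

/-- The slices of a word with more vertical strands to the left. -/
def indent (i : ℕ) (w : List Slice) : List Slice :=
  w.map fun s => ⟨s.piece, s.pos + i⟩

theorem pull_indent_cons (i : ℕ) (w : List Slice) (ψ : List Bool → R) (x : Bool) (l : List Bool) :
    pull A (indent (i + 1) w) ψ (x :: l) = pull A (indent i w) (fun l => ψ (x :: l)) l := by
  induction w generalizing l with
  | nil => rfl
  | cons s w ih =>
    simp only [indent, List.map_cons, pull] at ih ⊢
    rw [show s.pos + (i + 1) = s.pos + i + 1 by omega]
    simp only [act, ih]

theorem ActsAs.indent {c : R} {m : ℕ} {u v : List Slice} (h : ActsAs A c m u v) (i : ℕ) :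
    ActsAs A c (i + m) (indent i u) (indent i v) := by
  induction i with
  | zero => simpa [KauffmanBracket.indent] using h
  | succ i ih =>
    rintro ψ (_ | ⟨x, l⟩) hl
    · simp at hl
    · rw [pull_indent_cons, pull_indent_cons]
      exact ih _ l (by simp at hl; omega)

theorem actsAs_zigzag_right : ActsAs A 1 1 [⟨.cup, 0⟩, ⟨.cap, 1⟩] [] := by
  rintro ψ (_ | ⟨_ | _, l⟩) hl
  · simp at hl
  all_goals
    simp [pull, act, headAct, cupSum, capWeight, ← mul_assoc, ← mul_pow]

theorem actsAs_zigzag_left : ActsAs A 1 1 [⟨.cup, 1⟩, ⟨.cap, 0⟩] [] := by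
  rintro ψ (_ | ⟨_ | _, l⟩) hl
  · simp at hl
  all_goals
    simp [pull, act, headAct, cupSum, capWeight, ← mul_assoc, ← mul_pow]

theorem actsAs_slide_cap (e : Bool) :
    ActsAs A 1 3 [⟨.crossing e, 0⟩, ⟨.cap, 1⟩] [⟨.crossing (!e), 1⟩, ⟨.cap, 0⟩] := by
  have h : (A : R) * ↑A⁻¹ = 1 := A.mul_inv
  rintro ψ (_ | ⟨x, _ | ⟨y, _ | ⟨z, l⟩⟩⟩) hl
  iterate 3 simp at hl
  cases e <;> cases x <;> cases y <;> cases z <;>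
    simp only [pull, act, headAct, cupSum, capWeight, cond_true, cond_false, Bool.not_true,
      Bool.not_false] <;> grind

theorem actsAs_slide_cup (e : Bool) :
    ActsAs A 1 1 [⟨.cup, 1⟩, ⟨.crossing e, 0⟩] [⟨.cup, 0⟩, ⟨.crossing (!e), 1⟩] := by
  have h : (A : R) * ↑A⁻¹ = 1 := A.mul_inv
  rintro ψ (_ | ⟨x, l⟩) hl
  · simp at hl
  cases e <;> cases x <;>
    simp only [pull, act, headAct, cupSum, capWeight, cond_true, cond_false, Bool.not_true,
      Bool.not_false] <;> grind

/-- The factor by which a curl with a given crossing changes the bracket. -/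
theorem coe_curl_zpow (e : Bool) :
    ((curl A ^ (bif e then (-1 : ℤ) else 1) : Rˣ) : R) =
      bif e then -(↑A⁻¹ : R) ^ 3 else -(A : R) ^ 3 := by
  cases e
  · simp [curl]
  · have h : (curl A)⁻¹ = -A⁻¹ ^ 3 := inv_eq_of_mul_eq_one_right (by simp [curl])
    simp [h]

theorem actsAs_reidemeister_one_cap (e : Bool) :
    ActsAs A ↑(curl A ^ (bif e then (-1 : ℤ) else 1)) 2 [⟨.crossing e, 0⟩, ⟨.cap, 0⟩]
      [⟨.cap, 0⟩] := by
  have h : (A : R) * ↑A⁻¹ = 1 := A.mul_inv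
  rintro ψ (_ | ⟨x, _ | ⟨y, l⟩⟩) hl
  iterate 2 simp at hl
  rw [coe_curl_zpow]
  cases e <;> cases x <;> cases y <;>
    simp only [pull, act, headAct, cupSum, capWeight, cond_true, cond_false] <;> grind

theorem actsAs_reidemeister_one_cup (e : Bool) :
    ActsAs A ↑(curl A ^ (bif e then (-1 : ℤ) else 1)) 0 [⟨.cup, 0⟩, ⟨.crossing e, 0⟩]
      [⟨.cup, 0⟩] := by
  have h : (A : R) * ↑A⁻¹ = 1 := A.mul_inv
  intro ψ l _
  rw [coe_curl_zpow]
  cases e <;>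
    simp only [pull, act, headAct, cupSum, capWeight, cond_true, cond_false] <;> grind

theorem actsAs_reidemeister_two (e : Bool) :
    ActsAs A 1 2 [⟨.crossing e, 0⟩, ⟨.crossing (!e), 0⟩] [] := by
  have h : (A : R) * ↑A⁻¹ = 1 := A.mul_inv
  rintro ψ (_ | ⟨x, _ | ⟨y, l⟩⟩) hl
  iterate 2 simp at hl
  cases e <;> cases x <;> cases y <;>
    simp only [pull, act, headAct, cupSum, capWeight, cond_true, cond_false, Bool.not_true,
      Bool.not_false] <;> grind

theorem actsAs_reidemeister_three (e f g : Bool) (hfeg : f = e ∨ f = g) :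
    ActsAs A 1 3 [⟨.crossing e, 0⟩, ⟨.crossing f, 1⟩, ⟨.crossing g, 0⟩]
      [⟨.crossing g, 1⟩, ⟨.crossing f, 0⟩, ⟨.crossing e, 1⟩] := by
  have h : (A : R) * ↑A⁻¹ = 1 := A.mul_inv
  rintro ψ (_ | ⟨x, _ | ⟨y, _ | ⟨z, l⟩⟩⟩) hl
  iterate 3 simp at hl
  cases e <;> cases f <;> cases g <;> simp at hfeg <;> cases x <;> cases y <;> cases z <;>
    simp only [pull, act, headAct, cupSum, capWeight, cond_true, cond_false] <;> grind

theorem isTangle_append {u v : List Slice} {m n : ℕ} :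
    IsTangle (u ++ v) m n ↔ ∃ k, IsTangle u m k ∧ IsTangle v k n := by
  induction u generalizing m with
  | nil => simp [IsTangle]
  | cons s u ih => simp [IsTangle, ih, and_assoc]

/-- A local move changes the action on functionals by a power of the factor of a curl. -/
theorem exists_pull_eq_of_localMove {u v : List Slice} (h : LinkDiagram.LocalMove u v) {m n : ℕ}
    (hu : IsTangle u m n) :
    ∃ k : ℤ, ActsAs A ↑(curl A ^ k) m u v := by
  -- Each move is checked at the left end of a slice and then shifted by `i` strands; `hu` ensures
  -- that the slice has enough strands.
  have key {k : ℤ} {j i : ℕ} {u' v' : List Slice} (h' : ActsAs A ↑(curl A ^ k) j u' v')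
      (hj : i + j ≤ m) : ActsAs A ↑(curl A ^ k) m (indent i u') (indent i v') :=
    fun ψ l hl => h'.indent A i ψ l (hj.trans hl)
  have one : ((curl A ^ (0 : ℤ) : Rˣ) : R) = 1 := by simp
  cases h with
  | exchange x y i k =>
    exact ⟨0, fun ψ l _ => by simpa [pull] using act_exchange A x y i k ψ l⟩
  | zigzag_right i =>
    refine ⟨0, ?_⟩
    have := key (i := i) (one.symm ▸ actsAs_zigzag_right A)
    simp [IsTangle, Piece.ins, Piece.outs] at hu
    simpa [indent, Nat.add_comm 1] using this (by omega)
  | zigzag_left i =>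
    refine ⟨0, ?_⟩
    have := key (i := i) (one.symm ▸ actsAs_zigzag_left A)
    simp [IsTangle, Piece.ins, Piece.outs] at hu
    simpa [indent, Nat.add_comm 1] using this (by omega)
  | slide_cap i e =>
    refine ⟨0, ?_⟩
    have := key (i := i) (one.symm ▸ actsAs_slide_cap A e)
    simp [IsTangle, Piece.ins, Piece.outs] at hu
    simpa [indent, Nat.add_comm 1] using this (by omega)
  | slide_cup i e =>
    refine ⟨0, ?_⟩
    have := key (i := i) (one.symm ▸ actsAs_slide_cup A e)
    simp [IsTangle, Piece.ins, Piece.outs] at hu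
    simpa [indent, Nat.add_comm 1] using this (by omega)
  | reidemeister_one_cap i e =>
    refine ⟨bif e then -1 else 1, ?_⟩
    have := key (i := i) (actsAs_reidemeister_one_cap A e)
    simp [IsTangle, Piece.ins, Piece.outs] at hu
    simpa [indent] using this (by omega)
  | reidemeister_one_cup i e =>
    refine ⟨bif e then -1 else 1, ?_⟩
    have := key (i := i) (actsAs_reidemeister_one_cup A e)
    simp [IsTangle, Piece.ins, Piece.outs] at hu
    simpa [indent] using this (by omega)
  | reidemeister_two i e =>
    refine ⟨0, ?_⟩
    have := key (i := i) (one.symm ▸ actsAs_reidemeister_two A e)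
    simp [IsTangle, Piece.ins, Piece.outs] at hu
    simpa [indent] using this (by omega)
  | reidemeister_three i e f g hfeg =>
    refine ⟨0, ?_⟩
    have := key (i := i) (one.symm ▸ actsAs_reidemeister_three A e f g hfeg)
    simp [IsTangle, Piece.ins, Piece.outs] at hu
    simpa [indent, Nat.add_comm 1] using this (by omega)

/-! ### The bracket of a link diagram -/

/-- The functional on the empty set of strands. -/
def emptyFunctional (l : List Bool) : R := if l = [] then 1 else 0

/-- The Kauffman bracket of a link diagram, normalized to be `1` for the empty diagram. -/
def bracket (D : LinkDiagram) : R := pull A D.word emptyFunctional []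

theorem bracket_eq_of_move {D D' : LinkDiagram} (h : D.Move D') :
    ∃ k : ℤ, bracket A D = ↑(curl A ^ k) * bracket A D' := by
  obtain ⟨u, v, l, r, hlr, hD, hD'⟩ := h
  -- Closedness of the diagram gives the number of strands at the height of the move, which the
  -- length condition in `ActsAs` needs.
  have hc := D.closed
  rw [hD, isTangle_append] at hc
  obtain ⟨n, hc, -⟩ := hc
  rw [isTangle_append] at hc
  obtain ⟨m, hu, hl⟩ := hc
  obtain ⟨k, hk⟩ := exists_pull_eq_of_localMove A hlr hl
  refine ⟨k, ?_⟩
  simp only [bracket, hD, hD', pull_append]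
  rw [← pull_mul]
  exact pull_congr A hu (fun s hs => hk _ s hs.ge) rfl

/-- The Kauffman bracket is a link invariant up to powers of the factor of a curl. -/
theorem bracket_eq_of_link_eq {D D' : LinkDiagram}
    (h : (Quot.mk _ D : Link) = Quot.mk _ D') :
    ∃ k : ℤ, bracket A D = ↑(curl A ^ k) * bracket A D' := by
  have h' := Quot.eqvGen_exact h
  clear h
  induction h' with
  | rel _ _ h => exact bracket_eq_of_move A h
  | refl _ => exact ⟨0, by simp⟩
  | symm x y h ih =>
    obtain ⟨k, hk⟩ := ih
    exact ⟨-k, by rw [hk, ← mul_assoc, ← Units.val_mul, ← zpow_add]; simp⟩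
  | trans x y z h h' ih ih' =>
    obtain ⟨k, hk⟩ := ih
    obtain ⟨k', hk'⟩ := ih'
    exact ⟨k + k', by rw [hk, hk', zpow_add, Units.val_mul, mul_assoc]⟩

/-! ### Twists -/

/-- A maximum followed by a minimum on top of it. -/
def hook (i : ℕ) (ψ : List Bool → R) (l : List Bool) : R :=
  act A .cap i (act A .cup i ψ) l

theorem act_crossing (e : Bool) (i : ℕ) (ψ : List Bool → R) {l : List Bool}
    (hl : i + 2 ≤ l.length) :
    act A (.crossing e) i ψ l =
      (bif e then (A : R) else ↑A⁻¹) * ψ l + (bif e then (↑A⁻¹ : R) else A) * hook A i ψ l := by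
  induction i generalizing ψ l with
  | zero =>
    rcases l with _ | ⟨x, _ | ⟨y, l⟩⟩
    iterate 2 simp at hl
    rfl
  | succ i ih =>
    rcases l with _ | ⟨x, l⟩
    · simp at hl
    · exact ih _ (by simp at hl; omega)

/-- The value of a closed component. -/
def loop : R := -(A : R) ^ 2 - (↑A⁻¹ : R) ^ 2

theorem act_cup_hook (i : ℕ) (ψ : List Bool → R) {l : List Bool} (hl : i ≤ l.length) :
    act A .cup i (hook A i ψ) l = loop A * act A .cup i ψ l := by
  induction i generalizing ψ l with
  | zero =>
    simp only [act, headAct, hook, cupSum, capWeight, loop]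
    ring
  | succ i ih =>
    rcases l with _ | ⟨x, l⟩
    · simp at hl
    · exact ih _ (by simpa using hl)

theorem hook_congr {i : ℕ} {ψ φ : List Bool → R} {l : List Bool} (hl : i + 2 ≤ l.length)
    (h : ∀ l' : List Bool, l'.length = l.length → ψ l' = φ l') : hook A i ψ l = hook A i φ l := by
  refine act_congr A .cap i hl fun l' hl' => act_congr A .cup i ?_ fun s hs => h s ?_ <;>
    simp [Piece.ins, Piece.outs] at * <;> omega

/-- The Temperley–Lieb relation `h² = d h`: the minimum and the maximum between two hooks close up
to a loop. -/
theorem hook_hook (i : ℕ) (ψ : List Bool → R) {l : List Bool} (hl : i + 2 ≤ l.length) :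
    hook A i (hook A i ψ) l = loop A * hook A i ψ l := by
  rw [hook, hook, ← act_mul]
  exact act_congr A .cap i hl fun l' hl' =>
    act_cup_hook A i ψ (by simp [Piece.ins, Piece.outs] at hl'; omega)

theorem hook_linear (i : ℕ) (c d : R) (ψ φ : List Bool → R) (l : List Bool) :
    hook A i (fun l => c * ψ l + d * φ l) l = c * hook A i ψ l + d * hook A i φ l := by
  simp only [hook, ← act_linear]

/-- A row of crossings expanded into the vertical strands and the hook; `S n` is the coefficient of
the hook for `n` crossings. -/
theorem pull_replicate_crossing (e : Bool) (i n : ℕ) (S : ℕ → R) (h0 : S 0 = 0)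
    (hS : ∀ n, S (n + 1) = -(bif e then (↑A⁻¹ : R) else A) ^ 3 * S n +
      (bif e then (A : R) else ↑A⁻¹) ^ n * (bif e then (↑A⁻¹ : R) else A))
    (ψ : List Bool → R) {l : List Bool} (hl : i + 2 ≤ l.length) :
    pull A (List.replicate n ⟨.crossing e, i⟩) ψ l =
      (bif e then (A : R) else ↑A⁻¹) ^ n * ψ l + S n * hook A i ψ l := by
  induction n generalizing l with
  | zero => simp [pull, h0]
  | succ n ih =>
    -- With `s` the weight of the identity and `t = s⁻¹` that of the hook, `(s + t h)(sⁿ + S n h)`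
    -- has hook coefficient `(s + t d) S n + sⁿ t`, and `s + t d = -t³`.
    have h := A.mul_inv
    rw [List.replicate_succ, pull, act_crossing A e i _ hl, ih hl, hook_congr A hl
      (fun l' hl' => ih (hl'.ge.trans' hl)), hook_linear, hook_hook A i ψ hl, hS, loop]
    cases e <;> simp only [cond_true, cond_false] <;> grind

/-! ### Planar matchings of six points -/

section Matching

variable {R : Type*} [CommRing R] (A : Rˣ)

/-- Linear combinations of the functionals of the five planar matchings of the strands
`0, …, 5`. -/
def matching (u v w x y : R) : List Bool → R
  | [a, b, c, d, e, f] =>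
    u * (capWeight A b c * capWeight A d e * capWeight A a f) +
    v * (capWeight A a b * capWeight A d e * capWeight A c f) +
    w * (capWeight A c d * capWeight A b e * capWeight A a f) +
    x * (capWeight A e f * capWeight A b c * capWeight A a d) +
    y * (capWeight A a b * capWeight A c d * capWeight A e f)
  | _ => 0

/-- Linear combinations of the functionals of the two planar matchings of four strands. -/
def pairing (u v : R) : List Bool → R
  | [a, b, c, d] =>
    u * (capWeight A b c * capWeight A a d) + v * (capWeight A a b * capWeight A c d)
  | _ => 0

theorem exists_eq_of_length_eq_four {α : Type*} {l : List α} (hl : l.length = 4) :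
    ∃ a b c d, l = [a, b, c, d] := by
  rcases l with _ | ⟨a, _ | ⟨b, _ | ⟨c, _ | ⟨d, _ | ⟨e, l⟩⟩⟩⟩⟩ <;> simp at hl ⊢

theorem exists_eq_of_length_eq_six {α : Type*} {l : List α} (hl : l.length = 6) :
    ∃ a b c d e f, l = [a, b, c, d, e, f] := by
  rcases l with _ | ⟨a, _ | ⟨b, _ | ⟨c, _ | ⟨d, _ | ⟨e, _ | ⟨f, _ | ⟨g, l⟩⟩⟩⟩⟩⟩⟩ <;> simp at hl ⊢

variable (u v w x y : R) {l : List Bool}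

/-- A hook joins its two strands and also joins their former partners; if the strands were already
partners, a loop splits off. This and its four analogues are checked on all 64 labellings. -/
theorem hook_zero_matching (hl : l.length = 6) :
    hook A 0 (matching A u v w x y) l =
      matching A 0 (u + loop A * v) 0 0 (w + x + loop A * y) l := by
  have h := A.mul_inv
  obtain ⟨a, b, c, d, e, f, rfl⟩ := exists_eq_of_length_eq_six hl
  cases a <;> cases b <;> cases c <;> cases d <;> cases e <;> cases f <;>
    simp only [hook, act, headAct, cupSum, matching, capWeight, loop, mul_zero, zero_mul, add_zero,
      zero_add, mul_one, one_mul] <;> grind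

theorem hook_one_matching (hl : l.length = 6) :
    hook A 1 (matching A u v w x y) l =
      matching A (loop A * u + v + w) 0 0 (loop A * x + y) 0 l := by
  have h := A.mul_inv
  obtain ⟨a, b, c, d, e, f, rfl⟩ := exists_eq_of_length_eq_six hl
  cases a <;> cases b <;> cases c <;> cases d <;> cases e <;> cases f <;>
    simp only [hook, act, headAct, cupSum, matching, capWeight, loop, mul_zero, zero_mul, add_zero,
      zero_add, mul_one, one_mul] <;> grind

theorem hook_two_matching (hl : l.length = 6) :
    hook A 2 (matching A u v w x y) l =
      matching A 0 0 (u + loop A * w) 0 (v + x + loop A * y) l := by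
  have h := A.mul_inv
  obtain ⟨a, b, c, d, e, f, rfl⟩ := exists_eq_of_length_eq_six hl
  cases a <;> cases b <;> cases c <;> cases d <;> cases e <;> cases f <;>
    simp only [hook, act, headAct, cupSum, matching, capWeight, loop, mul_zero, zero_mul, add_zero,
      zero_add, mul_one, one_mul] <;> grind

theorem hook_three_matching (hl : l.length = 6) :
    hook A 3 (matching A u v w x y) l =
      matching A (loop A * u + w + x) (loop A * v + y) 0 0 0 l := by
  have h := A.mul_inv
  obtain ⟨a, b, c, d, e, f, rfl⟩ := exists_eq_of_length_eq_six hl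
  cases a <;> cases b <;> cases c <;> cases d <;> cases e <;> cases f <;>
    simp only [hook, act, headAct, cupSum, matching, capWeight, loop, mul_zero, zero_mul, add_zero,
      zero_add, mul_one, one_mul] <;> grind

theorem hook_four_matching (hl : l.length = 6) :
    hook A 4 (matching A u v w x y) l =
      matching A 0 0 0 (u + loop A * x) (v + w + loop A * y) l := by
  have h := A.mul_inv
  obtain ⟨a, b, c, d, e, f, rfl⟩ := exists_eq_of_length_eq_six hl
  cases a <;> cases b <;> cases c <;> cases d <;> cases e <;> cases f <;>
    simp only [hook, act, headAct, cupSum, matching, capWeight, loop, mul_zero, zero_mul, add_zero,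
      zero_add, mul_one, one_mul] <;> grind

theorem matching_linear (c d u' v' w' x' y' : R) :
    c * matching A u v w x y l + d * matching A u' v' w' x' y' l =
      matching A (c * u + d * u') (c * v + d * v') (c * w + d * w') (c * x + d * x')
        (c * y + d * y') l := by
  rcases l with _ | ⟨a, _ | ⟨b, _ | ⟨c, _ | ⟨d, _ | ⟨e, _ | ⟨f, _ | ⟨g, l⟩⟩⟩⟩⟩⟩⟩ <;>
    simp only [matching] <;> ring

/-- The three minima form the matching `12, 34, 05`; the exponents count the loops it closes with
each of the five matchings. -/
theorem pull_cups_matching :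
    pull A [⟨.cup, 0⟩, ⟨.cup, 1⟩, ⟨.cup, 3⟩] (matching A u v w x y) [] =
      loop A ^ 3 * u + loop A ^ 2 * (v + w + x) + loop A * y := by
  have h := A.mul_inv
  simp only [pull, act, headAct, cupSum, matching, capWeight, loop, mul_zero, zero_mul, add_zero,
    mul_one, one_mul]
  grind

theorem pull_two_caps_emptyFunctional {l : List Bool} (hl : l.length = 4) :
    pull A [⟨.cap, 0⟩, ⟨.cap, 0⟩] emptyFunctional l = pairing A 0 1 l := by
  obtain ⟨a, b, c, d, rfl⟩ := exists_eq_of_length_eq_four hl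
  simp [pull, act, headAct, pairing, emptyFunctional]

theorem hook_one_pairing {l : List Bool} (hl : l.length = 4) :
    hook A 1 (pairing A 0 1) l = pairing A 1 0 l := by
  have h := A.mul_inv
  obtain ⟨a, b, c, d, rfl⟩ := exists_eq_of_length_eq_four hl
  cases a <;> cases b <;> cases c <;> cases d <;>
    simp only [hook, act, headAct, cupSum, pairing, capWeight, mul_zero, zero_mul, add_zero,
      zero_add, mul_one, one_mul] <;> grind

theorem pairing_linear (c d : R) :
    c * pairing A 0 1 l + d * pairing A 1 0 l = pairing A d c l := by
  rcases l with _ | ⟨a, _ | ⟨b, _ | ⟨c, _ | ⟨d, _ | ⟨e, l⟩⟩⟩⟩⟩ <;> simp only [pairing] <;> ring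

theorem pull_cap_pairing (hl : l.length = 6) :
    pull A [⟨.cap, 2⟩] (pairing A u v) l = matching A 0 0 u 0 v l := by
  obtain ⟨a, b, c, d, e, f, rfl⟩ := exists_eq_of_length_eq_six hl
  simp only [pull, act, headAct, pairing, matching]
  ring

end Matching
-- Twists over the Laurent polynomials
open LaurentPolynomial

/-- The variable of the Laurent polynomials. -/
noncomputable def var : ℤ[T;T⁻¹]ˣ where
  val := T 1
  inv := T (-1)
  val_inv := by rw [← T_add]; exact T_zero
  inv_val := by rw [← T_add]; exact T_zero

theorem twistPolyNat_zero : twistPolyNat 0 = 0 := by simp [twistPolyNat]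

theorem twistPolyNat_succ (n : ℕ) :
    twistPolyNat (n + 1) = -T 3 * twistPolyNat n + T (1 - n) := by
  rw [twistPolyNat, Finset.sum_Icc_succ_top (by omega), twistPolyNat, Finset.mul_sum]
  congr 1
  · refine Finset.sum_congr rfl fun i hi => ?_
    rw [Nat.succ_sub (Finset.mem_Icc.mp hi).2, pow_succ]
    ring
  · simp only [Nat.sub_self, pow_zero, mul_one]
    congr 1
    push_cast
    ring

theorem pull_twist (i : ℕ) (k : ℤ) (ψ : List Bool → ℤ[T;T⁻¹]) {l : List Bool}
    (hl : i + 2 ≤ l.length) :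
    pull var (twist i k) ψ l = T (-k) * ψ l + twistPoly k * hook var i ψ l := by
  have hT : ((var : ℤ[T;T⁻¹]ˣ) : ℤ[T;T⁻¹]) = T 1 := rfl
  have hT' : ((var⁻¹ : ℤ[T;T⁻¹]ˣ) : ℤ[T;T⁻¹]) = T (-1) := rfl
  rw [twist, twistPoly]
  obtain ⟨n, rfl | rfl⟩ := k.eq_nat_or_neg
  · rw [if_pos (by omega), show decide ((n : ℤ) < 0) = false by simp,
      pull_replicate_crossing var false i _ twistPolyNat twistPolyNat_zero _ ψ hl]
    · simp [hT', T_pow]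
    · intro n
      simp only [cond_false, twistPolyNat_succ, hT, hT', T_pow, ← T_add]
      congr 2
      ring
  -- For `n = 0` the label `-n` falls under the nonnegative case of `twistPoly`.
  · rcases Nat.eq_zero_or_pos n with rfl | hn
    · simp [pull, twistPolyNat_zero]
    rw [if_neg (by omega), show decide (-(n : ℤ) < 0) = true by simpa using hn,
      pull_replicate_crossing var true i _ (fun n => invert (twistPolyNat n))
        (by simp [twistPolyNat_zero]) _ ψ hl]
    · simp [hT, T_pow]
    · intro n
      simp only [cond_true, twistPolyNat_succ, map_add, map_mul, map_neg, invert_T, hT, hT', T_pow,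
        ← T_add]
      congr 2
      ring

/-! ### Evaluation at `1 + ε` -/

/-- The unit `1 + ε` of the dual numbers. -/
def oneAddEps : (DualNumber ℤ)ˣ where
  val := 1 + DualNumber.eps
  inv := 1 - DualNumber.eps
  val_inv := by ring_nf; simp [pow_two]
  inv_val := by ring_nf; simp [pow_two]

/-- Evaluation of Laurent polynomials at `1 + ε`. -/
noncomputable def evalEps : ℤ[T;T⁻¹] →+* DualNumber ℤ :=
  eval₂ (Int.castRingHom _) oneAddEps

theorem coe_oneAddEps_zpow (n : ℤ) :
    ((oneAddEps ^ n : (DualNumber ℤ)ˣ) : DualNumber ℤ) = 1 + (n : DualNumber ℤ) * DualNumber.eps := by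
  have h : (DualNumber.eps : DualNumber ℤ) * DualNumber.eps = 0 := DualNumber.eps_mul_eps
  have h1 : (oneAddEps : DualNumber ℤ) = 1 + DualNumber.eps := rfl
  have h2 : ((oneAddEps⁻¹ : (DualNumber ℤ)ˣ) : DualNumber ℤ) = 1 - DualNumber.eps := rfl
  induction n with
  | zero => simp
  | succ n ih =>
    rw [zpow_add_one, Units.val_mul, ih, h1]
    push_cast
    linear_combination (n : DualNumber ℤ) * h
  | pred n ih =>
    rw [zpow_sub_one, Units.val_mul, ih, h2]
    push_cast
    linear_combination (n : DualNumber ℤ) * h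

theorem evalEps_T (n : ℤ) : evalEps (T n) = 1 + (n : DualNumber ℤ) * DualNumber.eps := by
  rw [evalEps, eval₂_T, coe_oneAddEps_zpow]

theorem fst_evalEps_T (n : ℤ) : (evalEps (T n)).fst = 1 := by simp [evalEps_T]

theorem snd_evalEps_T (n : ℤ) : (evalEps (T n)).snd = n := by simp [evalEps_T]

/-- At `A = 1` the recursion reads `S_(n+1) = 1 - S_n`, so the values alternate between `0` and `1`;
inverting `A` changes nothing there. -/
theorem fst_evalEps_twistPolyNat_two_mul (m : ℕ) :
    (evalEps (twistPolyNat (2 * m))).fst = 0 ∧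
      (evalEps (invert (twistPolyNat (2 * m)))).fst = 0 := by
  induction m with
  | zero => simp [twistPolyNat_zero]
  | succ m ih =>
    simp [Nat.mul_succ, twistPolyNat_succ, fst_evalEps_T, ih]

theorem fst_evalEps_twistPoly {k : ℤ} (hk : Even k) : (evalEps (twistPoly k)).fst = 0 := by
  obtain ⟨j, rfl⟩ := hk
  rw [twistPoly]
  split_ifs with h
  · rw [show (j + j).toNat = 2 * j.toNat by omega]
    exact (fst_evalEps_twistPolyNat_two_mul _).1
  · rw [show (-(j + j)).toNat = 2 * (-j).toNat by omega]
    exact (fst_evalEps_twistPolyNat_two_mul _).2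

theorem loop_var : loop var = -T 2 - T (-2) := by
  have hT : ((var : ℤ[T;T⁻¹]ˣ) : ℤ[T;T⁻¹]) = T 1 := rfl
  have hT' : ((var⁻¹ : ℤ[T;T⁻¹]ˣ) : ℤ[T;T⁻¹]) = T (-1) := rfl
  simp [loop, hT, hT', T_pow]

theorem fst_evalEps_loop : (evalEps (loop var)).fst = -2 := by
  simp [loop_var, fst_evalEps_T]

theorem snd_evalEps_loop : (evalEps (loop var)).snd = 0 := by
  simp [loop_var, snd_evalEps_T]

/-- Sign and exponent are separated because the value at `1` detects the first and the derivative
the second. -/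
theorem coe_curl_var_zpow (k : ℤ) :
    ∃ s : ℤ, (s = 1 ∨ s = -1) ∧ ((curl var ^ k : ℤ[T;T⁻¹]ˣ) : ℤ[T;T⁻¹]) = (s : ℤ[T;T⁻¹]) * T (3 * k) := by
  have hT (n : ℤ) : ((var ^ n : ℤ[T;T⁻¹]ˣ) : ℤ[T;T⁻¹]) = T n := by
    induction n with
    | zero => simp
    | succ n ih => rw [zpow_add_one, Units.val_mul, ih, T_add]; rfl
    | pred n ih => rw [zpow_sub_one, Units.val_mul, ih, sub_eq_add_neg, T_add]; rfl
  have h : curl var = -1 * var ^ (3 : ℤ) := by simp [curl]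
  have hs : (-1 : ℤ[T;T⁻¹]ˣ) ^ k = 1 ∨ (-1 : ℤ[T;T⁻¹]ˣ) ^ k = -1 := by
    obtain ⟨j, rfl | rfl⟩ := k.even_or_odd'
    · simp [zpow_mul]
    · simp [zpow_mul, zpow_add]
  rw [h, mul_zpow, ← zpow_mul, Units.val_mul, hT]
  rcases hs with hs | hs
  · exact ⟨1, by simp [hs]⟩
  · exact ⟨-1, by simp [hs]⟩

theorem pull_twist_of_eq {n i : ℕ} (hi : i + 2 ≤ n) {ψ φ φ' : List Bool → ℤ[T;T⁻¹]}
    (hψ : ∀ l : List Bool, l.length = n → ψ l = φ l)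
    (hφ : ∀ l : List Bool, l.length = n → hook var i φ l = φ' l) (k : ℤ) (l : List Bool)
    (hl : l.length = n) :
    pull var (twist i k) ψ l = T (-k) * φ l + twistPoly k * φ' l := by
  have h : i + 2 ≤ l.length := hl.symm ▸ hi
  rw [pull_twist i k ψ h, hψ l hl, hook_congr var h fun l' hl' => hψ l' (hl'.trans hl), hφ l hl]

/-! ### The bracket of `K(p, q, r; a, b, c)` -/

/-- The polynomial in the coefficients of the smoothings of the six bands of `K(p, q, r; a, b, c)`
that is the Kauffman bracket. The uncut bands have the weights `x`, the cut bands the weights `y`. -/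
def girthThreePoly {R : Type*} [CommRing R] (d : R) (x y : ℤ → R) (p q r a b c : ℤ) : R :=
  x p * x q * x r * (d * (x a * x b * x c) +
    d ^ 2 * (y a * x b * x c + x a * y b * x c + x a * x b * y c) +
    d ^ 3 * (y a * y b * x c + y a * x b * y c + x a * y b * y c + d * (y a * y b * y c))) +
  (y p * x q * x r) * (d ^ 2 * (x a * x b * x c) +
    d * (y a * x b * x c + x a * x b * y c) + d ^ 3 * (x a * y b * x c) +
    d ^ 2 * (y a * y b * x c + y a * x b * y c + x a * y b * y c + d * (y a * y b * y c))) +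
  (x p * y q * x r) * (d ^ 2 * (x a * x b * x c) +
    d * (y a * x b * x c + x a * y b * x c) + d ^ 3 * (x a * x b * y c) +
    d ^ 2 * (y a * y b * x c + y a * x b * y c + x a * y b * y c + d * (y a * y b * y c))) +
  (x p * x q * y r) * (d ^ 2 * (x a * x b * x c) +
    d * (x a * y b * x c + x a * x b * y c) + d ^ 3 * (y a * x b * x c) +
    d ^ 2 * (y a * y b * x c + y a * x b * y c + x a * y b * y c + d * (y a * y b * y c))) +
  (y p * y q * x r + y p * x q * y r + x p * y q * y r + d * (y p * y q * y r)) *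
    (d ^ 3 * (x a * x b * x c) +
      d ^ 2 * (y a * x b * x c + x a * y b * x c + x a * x b * y c) +
      d * (y a * y b * x c + y a * x b * y c + x a * y b * y c + d * (y a * y b * y c)))

theorem bracket_girthThreeDiagram (p q r a b c : ℤ) :
    bracket var (girthThreeDiagram p q r a b c) =
      girthThreePoly (loop var) (fun k => T (-k)) twistPoly p q r a b c := by
  -- The diagram is evaluated from the top down; at each height the functional is kept as a
  -- combination of planar matchings.
  have h₀ (l : List Bool) (hl : l.length = 4) := pull_two_caps_emptyFunctional var hl
  have h₁ (l : List Bool) (hl : l.length = 4) :=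
    (pull_twist_of_eq (by norm_num) h₀ (fun l hl => hook_one_pairing var hl) c l hl).trans
      (pairing_linear var _ _)
  have h₂ (l : List Bool) (hl : l.length = 6) :=
    (pull_congr var (w := [⟨.cap, 2⟩]) (n := 4)
      (by simp [IsTangle, Piece.ins, Piece.outs]) h₁ hl).trans (pull_cap_pairing var _ _ hl)
  have h₃ (l : List Bool) (hl : l.length = 6) :=
    (pull_twist_of_eq (by norm_num) h₂ (fun l hl => hook_three_matching var _ _ _ _ _ hl) b l
      hl).trans (matching_linear var _ _ _ _ _ _ _ _ _ _ _ _)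
  have h₄ (l : List Bool) (hl : l.length = 6) :=
    (pull_twist_of_eq (by norm_num) h₃ (fun l hl => hook_one_matching var _ _ _ _ _ hl) a l
      hl).trans (matching_linear var _ _ _ _ _ _ _ _ _ _ _ _)
  have h₅ (l : List Bool) (hl : l.length = 6) :=
    (pull_twist_of_eq (by norm_num) h₄ (fun l hl => hook_four_matching var _ _ _ _ _ hl) r l
      hl).trans (matching_linear var _ _ _ _ _ _ _ _ _ _ _ _)
  have h₆ (l : List Bool) (hl : l.length = 6) :=
    (pull_twist_of_eq (by norm_num) h₅ (fun l hl => hook_two_matching var _ _ _ _ _ hl) q l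
      hl).trans (matching_linear var _ _ _ _ _ _ _ _ _ _ _ _)
  have h₇ (l : List Bool) (hl : l.length = 6) :=
    (pull_twist_of_eq (by norm_num) h₆ (fun l hl => hook_zero_matching var _ _ _ _ _ hl) p l
      hl).trans (matching_linear var _ _ _ _ _ _ _ _ _ _ _ _)
  have h₈ := (pull_congr var (w := [⟨.cup, 0⟩, ⟨.cup, 1⟩, ⟨.cup, 3⟩]) (m := 0) (n := 6) (l := [])
      (by simp [IsTangle, Piece.ins, Piece.outs]) h₇ rfl).trans (pull_cups_matching var _ _ _ _ _)
  simp only [bracket, girthThreeDiagram, pull_append]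
  rw [h₈]
  rw [girthThreePoly]
  ring

theorem map_girthThreePoly {R S : Type*} [CommRing R] [CommRing S] (φ : R →+* S) (d : R)
    (x y : ℤ → R) (p q r a b c : ℤ) :
    φ (girthThreePoly d x y p q r a b c) =
      girthThreePoly (φ d) (fun k => φ (x k)) (fun k => φ (y k)) p q r a b c := by
  simp only [girthThreePoly, map_add, map_mul, map_pow]

/-! ### Removing the framing ambiguity -/

/-- The contribution of a band to the derivative of the bracket at `1`. -/
noncomputable def bandSlope (k : ℤ) : ℤ := 2 * k + 4 * (evalEps (twistPoly k)).snd

/-- For even labels the weight of a cut band is a multiple of `ε`, so at most one band may be cut.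
The uncut state is one loop and each state with a single cut is two loops. Since `d` evaluates to
`-2` without an `ε` term, a band contributes `(-k)(-2)` when uncut and `(-2)² = 4` times the slope
of `S_k` when cut. -/
theorem evalEps_bracket_girthThreeDiagram {p q r a b c : ℤ} (hp : Even p) (hq : Even q)
    (hr : Even r) (ha : Even a) (hb : Even b) (hc : Even c) :
    (evalEps (bracket var (girthThreeDiagram p q r a b c))).fst = -2 ∧
      (evalEps (bracket var (girthThreeDiagram p q r a b c))).snd =
        bandSlope p + bandSlope q + bandSlope r + (bandSlope a + bandSlope b + bandSlope c) := by
  have hy {k : ℤ} (hk : Even k) := fst_evalEps_twistPoly hk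
  rw [bracket_girthThreeDiagram, map_girthThreePoly, girthThreePoly]
  constructor
  · simp [fst_evalEps_T, fst_evalEps_loop, hy hp, hy hq, hy hr, hy ha, hy hb, hy hc]
  · simp [fst_evalEps_T, snd_evalEps_T, fst_evalEps_loop, snd_evalEps_loop, hy hp, hy hq, hy hr,
      hy ha, hy hb, hy hc, pow_two, bandSlope]
    ring

/-- If the labels are even and `a', b', c'` are `a, b, c` in another order, the brackets of equal
links are equal, not only up to a power of the factor of a curl: the value at `1 + ε` determines the
power. -/
theorem bracket_eq_of_girthThreeLink_eq {p q r a b c a' b' c' : ℤ} (hp : Even p) (hq : Even q)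
    (hr : Even r) (ha : Even a) (hb : Even b) (hc : Even c) (ha' : Even a') (hb' : Even b')
    (hc' : Even c') (hperm : ∀ g : ℤ → ℤ, g a + g b + g c = g a' + g b' + g c')
    (h : girthThreeLink p q r a b c = girthThreeLink p q r a' b' c') :
    bracket var (girthThreeDiagram p q r a b c) =
      bracket var (girthThreeDiagram p q r a' b' c') := by
  obtain ⟨k, hk⟩ := bracket_eq_of_link_eq var h
  obtain ⟨s, hs, hsk⟩ := coe_curl_var_zpow k
  rw [hsk] at hk
  have h1 := congrArg (fun x => (evalEps x).fst) hk
  have h2 := congrArg (fun x => (evalEps x).snd) hk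
  obtain ⟨e1, e2⟩ := evalEps_bracket_girthThreeDiagram hp hq hr ha hb hc
  obtain ⟨e1', e2'⟩ := evalEps_bracket_girthThreeDiagram hp hq hr ha' hb' hc'
  rw [← hperm bandSlope, ← e2] at e2'
  -- With `σ` the common slope, the two components read `-2 = -2 s` and `σ = s (σ - 6 k)`, up to
  -- rearrangement.
  simp [fst_evalEps_T, snd_evalEps_T, e1, e1', e2'] at h1 h2
  have hs1 : s = 1 := by omega
  subst hs1
  have hk0 : k = 0 := by
    simp at h2
    omega
  simpa [hk0] using hk

/-! ### Comparison under cyclic permutations -/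

/-- At `A = 1` the value is `(-2)³ + 2 = -6`. -/
theorem loop_var_ne : loop var ^ 3 - loop var ≠ 0 := by
  intro h
  have h1 := congrArg (fun x => (evalEps x).fst) h
  simp [fst_evalEps_loop] at h1

/-- Every monomial contains exactly one weight, `x` or `y`, for each of the six bands. -/
theorem girthThreePoly_eq_mul {R : Type*} [CommRing R] (d : R) {x y z : ℤ → R}
    (hy : ∀ k, y k = x k * z k) (p q r a b c : ℤ) :
    girthThreePoly d x y p q r a b c =
      x p * x q * x r * (x a * x b * x c) * girthThreePoly d 1 z p q r a b c := by
  simp only [girthThreePoly, hy, Pi.one_apply]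
  ring

/-- Cyclic permutations of `a, b, c` change only the pairing of the bands that face each other. -/
theorem girthThreePoly_one_sub {R : Type*} [CommRing R] (d : R) (z : ℤ → R) (p q r a b c : ℤ) :
    girthThreePoly d 1 z p q r a b c - girthThreePoly d 1 z p q r c a b =
      (d ^ 3 - d) * (z p * (z b - z a) + z q * (z c - z b) + z r * (z a - z c)) := by
  simp only [girthThreePoly, Pi.one_apply]
  ring

theorem pairing_eq_of_bracket_eq {p q r a b c : ℤ}
    (h : bracket var (girthThreeDiagram p q r a b c) =
      bracket var (girthThreeDiagram p q r c a b)) :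
    let z : ℤ → ℤ[T;T⁻¹] := fun k => twistPoly k * T k
    z p * (z b - z a) + z q * (z c - z b) + z r * (z a - z c) = 0 := by
  intro z
  have hz (k : ℤ) : twistPoly k = T (-k) * z k := by
    rw [mul_left_comm, ← T_add, neg_add_cancel, T_zero, mul_one]
  -- The unit prefactors of the two brackets differ only in the order of the factors; once they are
  -- matched, the prefactor can be pulled out of the difference.
  rw [bracket_girthThreeDiagram, bracket_girthThreeDiagram, girthThreePoly_eq_mul _ hz,
    girthThreePoly_eq_mul _ hz, show T (-c) * T (-a) * T (-b) = T (-a) * T (-b) * T (-c) by ring,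
    ← sub_eq_zero, ← mul_sub, girthThreePoly_one_sub] at h
  have hu (k : ℤ) : IsUnit (T (R := ℤ) k) := isUnit_T k
  have hunit := ((hu (-p)).mul (hu (-q))).mul (hu (-r)) |>.mul
    (((hu (-a)).mul (hu (-b))).mul (hu (-c)))
  exact (mul_eq_zero.mp (hunit.mul_right_eq_zero.mp h)).resolve_left loop_var_ne

end KauffmanBracket

open KauffmanBracket LaurentPolynomial in
theorem theorem4p8 (p q r a b c : ℤ) (hp : Even p) (hq : Even q) (hr : Even r)
    (ha : Even a) (hb : Even b) (hc : Even c) :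
    (girthThreeLink p q r a b c = girthThreeLink p q r c a b →
      Matrix.det
        !![twistPoly p * LaurentPolynomial.T p, twistPoly q * LaurentPolynomial.T q,
            twistPoly r * LaurentPolynomial.T r;
          twistPoly c * LaurentPolynomial.T c, twistPoly a * LaurentPolynomial.T a,
            twistPoly b * LaurentPolynomial.T b;
          1, 1, 1] = 0) ∧
    (girthThreeLink p q r a b c = girthThreeLink p q r b c a →
      Matrix.det
        !![twistPoly p * LaurentPolynomial.T p, twistPoly q * LaurentPolynomial.T q,
            twistPoly r * LaurentPolynomial.T r;
          twistPoly a * LaurentPolynomial.T a, twistPoly b * LaurentPolynomial.T b,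
            twistPoly c * LaurentPolynomial.T c;
          1, 1, 1] = 0) := by
  have hdet (x₁ x₂ x₃ y₁ y₂ y₃ : ℤ[T;T⁻¹]) : Matrix.det !![x₁, x₂, x₃; y₁, y₂, y₃; 1, 1, 1] =
      x₁ * (y₂ - y₃) - x₂ * (y₁ - y₃) + x₃ * (y₁ - y₂) := by
    simp [Matrix.det_fin_three]
    ring
  constructor <;> intro h
  · have hbr := bracket_eq_of_girthThreeLink_eq hp hq hr ha hb hc hc ha hb (fun g => by ring) h
    rw [hdet]
    linear_combination -pairing_eq_of_bracket_eq hbr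
  · have hbr := bracket_eq_of_girthThreeLink_eq hp hq hr ha hb hc hb hc ha (fun g => by ring) h
    rw [hdet]
    -- The first case for the labels `b, c, a`, whose rotation is `a, b, c`.
    linear_combination -pairing_eq_of_bracket_eq hbr.symm
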